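/- Let $\mathfrak{c}=2^{\aleph_0}$. A zero set of $\mathbb{R}$ is a set of the form $\{x\in\mathbb{R} : f(x)=0\}$ with $f:\mathbb{R}\to\mathbb{R}$ continuous; let $\mathbf{Z}[\mathbb{R}]$ be the family of all zero sets of $\mathbb{R}$. A $z$-filter on $\mathbb{R}$ is a non-empty proper subset $\mathcal{F}$ of $\mathbf{Z}[\mathbb{R}]$ such that $Z_1\cap Z_2\in\mathcal{F}$ whenever $Z_1,Z_2\in\mathcal{F}$, and $Z_2\in\mathcal{F}$ whenever $Z_1\in\mathcal{F}$, $Z_2\in\mathbf{Z}[\mathbb{R}]$ and $Z_1\subseteq Z_2$. A $z$-filter $\mathcal{P}$ is prime if $Z_1\cup Z_2\notin\mathcal{P}$ whenever $Z_1,Z_2\in\mathbf{Z}[\mathbb{R}]\setminus\mathcal{P}$. Let $\kappa$ be any ordinal of cardinality $\mathfrak{c}$. Then there exists a well-ordered increasing chain of order type $\kappa$ of prime $z$-filters on $\mathbb{R}$, that is, a family $(\mathcal{Q}_\alpha)_{\alpha<\kappa}$ of prime $z$-filters on $\mathbb{R}$ such that $\mathcal{Q}_\alpha\subsetneq\mathcal{Q}_\beta$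 whenever $\alpha<\beta<\kappa$. -/

import Mathlib

/-- The family of zero sets of a topological space `X`: all sets of the form `{x | f x = 0}`
with `f` a continuous real-valued function on `X`. -/
def zeroSets (X : Type*) [TopologicalSpace X] : Set (Set X) :=
  {Z | ∃ f : C(X, ℝ), Z = {x | f x = 0}}

/-- A `z`-filter on `X`: a non-empty proper subset of the family of zero sets of `X` that is
closed under finite intersections and under supersets (among zero sets). -/
structure IsZFilter {X : Type*} [TopologicalSpace X] (F : Set (Set X)) : Prop where
  nonempty : F.Nonempty
  ssubset_zeroSets : F ⊂ zeroSets X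
  inter_mem : ∀ Z₁ ∈ F, ∀ Z₂ ∈ F, Z₁ ∩ Z₂ ∈ F
  mem_of_superset : ∀ Z₁ ∈ F, ∀ Z₂ ∈ zeroSets X, Z₁ ⊆ Z₂ → Z₂ ∈ F

/-- A prime `z`-filter on `X`: a `z`-filter such that the union of two zero sets outside of it
is again outside of it. -/
structure IsPrimeZFilter {X : Type*} [TopologicalSpace X] (P : Set (Set X)) : Prop
    extends IsZFilter P where
  union_notMem : ∀ Z₁ ∈ zeroSets X, ∀ Z₂ ∈ zeroSets X, Z₁ ∉ P → Z₂ ∉ P → Z₁ ∪ Z₂ ∉ P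

/-!
Let `A i ⊆ S` (`i ∈ ι`) be infinite sets with pairwise finite intersections, and let `C i` be the
closed set of the points of `S → Bool` that vanish on `A i`. Given an ultrafilter `U` on
`S → Bool`, change `U`-generic points at one coordinate in `A a`, generic for a nonprincipal
ultrafilter, setting it to `true`. The changed points converge to the original ones, so a closed
set that belongs to the new ultrafilter belongs to `U`; the new ultrafilter omits `C a`, while for
`i ≠ a` it contains `C i` if and only if `U` does. Iterating this yields, for each finite set of
indices `i`, an increasing family `W` of ultrafilters with `C i ∈ W j ↔ i < j` for these `i` and
all `j`. A limit of these families along an ultrafilter on the finite sets does so for all `i` at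
once.

Since there are `𝔠` almost disjoint subsets of `ℕ`, every linear order of cardinality at most `𝔠`
embeds into the prime `z`-filters on the Cantor space. An uncountable Polish space contains a copy
of the Cantor space whose zero sets extend to the whole space by Tietze's theorem, so the chains
can be pushed forward along the inclusion.
-/

open Filter Topology

section ZeroSets

variable {X Y : Type*} [TopologicalSpace X] [TopologicalSpace Y]

theorem univ_mem_zeroSets : Set.univ ∈ zeroSets X :=
  ⟨0, by simp⟩

theorem empty_mem_zeroSets : ∅ ∈ zeroSets X :=
  ⟨1, by simp⟩

theorem inter_mem_zeroSets {Z₁ Z₂ : Set X} (h₁ : Z₁ ∈ zeroSets X) (h₂ : Z₂ ∈ zeroSets X) :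
    Z₁ ∩ Z₂ ∈ zeroSets X := by
  obtain ⟨f, rfl⟩ := h₁
  obtain ⟨g, rfl⟩ := h₂
  refine ⟨f * f + g * g, Set.ext fun x => ?_⟩
  simp [mul_self_add_mul_self_eq_zero]

theorem preimage_mem_zeroSets {e : X → Y} (he : Continuous e) {Z : Set Y} (hZ : Z ∈ zeroSets Y) :
    e ⁻¹' Z ∈ zeroSets X := by
  obtain ⟨f, rfl⟩ := hZ
  exact ⟨f.comp ⟨e, he⟩, rfl⟩

theorem isClosed_of_mem_zeroSets {Z : Set X} (hZ : Z ∈ zeroSets X) : IsClosed Z := by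
  obtain ⟨f, rfl⟩ := hZ
  exact isClosed_eq f.continuous continuous_const

theorem mem_zeroSets_of_isClosed [TopologicalSpace.PseudoMetrizableSpace X] {C : Set X}
    (hC : IsClosed C) : C ∈ zeroSets X := by
  let := TopologicalSpace.pseudoMetrizableSpacePseudoMetric X
  rcases C.eq_empty_or_nonempty with rfl | hne
  · exact empty_mem_zeroSets
  · exact ⟨⟨fun x => Metric.infDist x C, Metric.continuous_infDist_pt C⟩,
      Set.ext fun x => hC.mem_iff_infDist_zero hne⟩

theorem exists_preimage_eq_of_mem_zeroSets [NormalSpace Y] {e : X → Y} (he : IsClosedEmbedding e)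
    {Z : Set X} (hZ : Z ∈ zeroSets X) : ∃ Z' ∈ zeroSets Y, e ⁻¹' Z' = Z := by
  obtain ⟨f, rfl⟩ := hZ
  obtain ⟨g, hg⟩ := f.exists_extension he
  refine ⟨{y | g y = 0}, ⟨g, rfl⟩, Set.ext fun x => ?_⟩
  simp [← hg]

end ZeroSets

section ZeroSetTrace

variable {X Y ι : Type*} [TopologicalSpace X] [TopologicalSpace Y]

/-- The trace of an ultrafilter `U` on the family of zero sets, which is the prime `z`-filter
induced by `U`. -/
def zeroSetTrace (U : Ultrafilter X) : Set (Set X) :=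
  {Z | Z ∈ zeroSets X ∧ Z ∈ U}

theorem isPrimeZFilter_zeroSetTrace (U : Ultrafilter X) : IsPrimeZFilter (zeroSetTrace U) where
  nonempty := ⟨Set.univ, univ_mem_zeroSets, univ_mem⟩
  ssubset_zeroSets := ⟨fun _ hZ => hZ.1, fun h => U.empty_notMem (h empty_mem_zeroSets).2⟩
  inter_mem _ h₁ _ h₂ := ⟨inter_mem_zeroSets h₁.1 h₂.1, inter_mem h₁.2 h₂.2⟩
  mem_of_superset _ h₁ _ h₂ h := ⟨h₂, mem_of_superset h₁.2 h⟩
  union_notMem _ h₁ _ h₂ h₁U h₂U h :=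
    (Ultrafilter.union_mem_iff.1 h.2).elim (fun hU => h₁U ⟨h₁, hU⟩) fun hU => h₂U ⟨h₂, hU⟩

theorem zeroSetTrace_map_subset_zeroSetTrace_map_iff [NormalSpace Y] {e : X → Y}
    (he : IsClosedEmbedding e) {U V : Ultrafilter X} :
    zeroSetTrace (U.map e) ⊆ zeroSetTrace (V.map e) ↔ zeroSetTrace U ⊆ zeroSetTrace V := by
  refine ⟨fun h Z hZ => ?_, fun h Z hZ => ?_⟩
  · obtain ⟨Z', hZ', rfl⟩ := exists_preimage_eq_of_mem_zeroSets he hZ.1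
    exact ⟨hZ.1, (h ⟨hZ', hZ.2⟩).2⟩
  · exact ⟨hZ.1, (h ⟨preimage_mem_zeroSets he.continuous hZ.1, hZ.2⟩).2⟩

theorem strictMono_zeroSetTrace_map [NormalSpace Y] [Preorder ι] {e : X → Y}
    (he : IsClosedEmbedding e) {W : ι → Ultrafilter X}
    (hW : StrictMono fun i => zeroSetTrace (W i)) :
    StrictMono fun i => zeroSetTrace ((W i).map e) := fun i j hij => by
  have h := hW hij
  simp only [ssubset_iff_subset_not_subset] at h ⊢
  simpa only [zeroSetTrace_map_subset_zeroSetTrace_map_iff he] using h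

theorem strictMono_zeroSetTrace_of_mem_iff_lt [Preorder ι] {W : ι → Ultrafilter X}
    (hW : Monotone fun i => zeroSetTrace (W i)) {Z : ι → Set X} (hZ : ∀ i, Z i ∈ zeroSets X)
    (hZW : ∀ i j, Z i ∈ W j ↔ i < j) : StrictMono fun i => zeroSetTrace (W i) :=
  fun i j hij => (hW hij.le).lt_of_not_ge fun hji =>
    lt_irrefl i ((hZW i i).1 (hji ⟨hZ i, (hZW i j).2 hij⟩).2)

theorem exists_monotone_zeroSetTrace_of_forall_finset [Preorder ι] (Z : ι → Set X)
    (h : ∀ F : Finset ι, ∃ W : ι → Ultrafilter X, Monotone (fun i => zeroSetTrace (W i)) ∧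
      ∀ i ∈ F, ∀ j, Z i ∈ W j ↔ i < j) :
    ∃ W : ι → Ultrafilter X, Monotone (fun i => zeroSetTrace (W i)) ∧
      ∀ i j, Z i ∈ W j ↔ i < j := by
  choose W hmono hsep using h
  let 𝒰 : Ultrafilter (Finset ι) := Ultrafilter.of atTop
  have mem_bind (C : Set X) (j : ι) : C ∈ 𝒰.bind (W · j) ↔ ∀ᶠ F in 𝒰, C ∈ W F j := Iff.rfl
  refine ⟨fun j => 𝒰.bind (W · j), fun i j hij C hC => ⟨hC.1, ?_⟩, fun i j => ?_⟩
  · exact ((mem_bind C i).1 hC.2).mono fun F hF => (hmono F hij ⟨hC.1, hF⟩).2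
  · have hiF : ∀ᶠ F : Finset ι in 𝒰, i ∈ F :=
      Ultrafilter.of_le atTop <|
        (eventually_ge_atTop {i}).mono fun F => Finset.singleton_subset_iff.1
    rw [mem_bind, eventually_congr (hiF.mono fun F hF => hsep F i hF j), eventually_const]

end ZeroSetTrace

section SwitchOn

variable {S : Type*}

/-- The closed set of the points of `S → Bool` that vanish on `A`. In the chains below, these sets
witness that inclusions are strict. -/
def vanishingOn (A : Set S) : Set (S → Bool) :=
  {y | ∀ s ∈ A, y s = false}

theorem isClosed_vanishingOn (A : Set S) : IsClosed (vanishingOn A) := by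
  simp only [vanishingOn, Set.ofPred_forall]
  exact isClosed_biInter fun s _ => isClosed_eq (continuous_apply s) continuous_const

variable [DecidableEq S]

/-- The ultrafilter of the points `y` with coordinate `s` switched to `true`, where `y` is
`U`-generic and then `s` is `𝒱`-generic, chosen depending on `y`. -/
def switchOn (U : Ultrafilter (S → Bool)) (𝒱 : Ultrafilter S) : Ultrafilter (S → Bool) :=
  U.bind fun y => 𝒱.map fun s => Function.update y s true

variable {U : Ultrafilter (S → Bool)} {𝒱 : Ultrafilter S}

theorem mem_switchOn {C : Set (S → Bool)} :
    C ∈ switchOn U 𝒱 ↔ ∀ᶠ y in U, ∀ᶠ s in 𝒱, Function.update y s true ∈ C :=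
  Iff.rfl

theorem tendsto_update_cofinite {β : Type*} [TopologicalSpace β] (y : S → β) (b : β) :
    Tendsto (fun s => Function.update y s b) cofinite (𝓝 y) :=
  tendsto_pi_nhds.2 fun t => tendsto_nhds_of_eventually_eq <|
    (eventually_cofinite_ne t).mono fun _ hs => Function.update_of_ne hs.symm _ _

theorem zeroSetTrace_switchOn_subset (h𝒱 : (𝒱 : Filter S) ≤ cofinite) :
    zeroSetTrace (switchOn U 𝒱) ⊆ zeroSetTrace U := fun _ hZ =>
  ⟨hZ.1, Eventually.mono (mem_switchOn.1 hZ.2) fun y hy =>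
    (isClosed_of_mem_zeroSets hZ.1).mem_of_tendsto
      ((tendsto_update_cofinite y true).mono_left h𝒱) hy⟩

theorem vanishingOn_notMem_switchOn {A : Set S} (hA : A ∈ 𝒱) :
    vanishingOn A ∉ switchOn U 𝒱 := fun h => by
  obtain ⟨y, hy⟩ := (mem_switchOn.1 h).exists
  obtain ⟨s, hs, hsA⟩ := (hy.and hA).exists
  simpa using hs s hsA

theorem update_mem_vanishingOn_iff {A : Set S} {y : S → Bool} {s : S} (hs : s ∉ A) (b : Bool) :
    Function.update y s b ∈ vanishingOn A ↔ y ∈ vanishingOn A :=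
  forall₂_congr fun t ht => by rw [Function.update_of_ne (ne_of_mem_of_not_mem ht hs)]

theorem vanishingOn_mem_switchOn_iff {A : Set S} (hA : Aᶜ ∈ 𝒱) :
    vanishingOn A ∈ switchOn U 𝒱 ↔ vanishingOn A ∈ U := by
  have update_mem_iff (y : S → Bool) :
      (∀ᶠ s in 𝒱, Function.update y s true ∈ vanishingOn A) ↔ y ∈ vanishingOn A := by
    rw [eventually_congr (Eventually.mono hA fun s hs => update_mem_vanishingOn_iff hs true),
      eventually_const]
  simp only [mem_switchOn, update_mem_iff]
  rfl

end SwitchOn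

section AlmostDisjoint

variable {S ι : Type*}

theorem exists_ultrafilter_le_cofinite_mem {A : Set S} (hA : A.Infinite) :
    ∃ 𝒱 : Ultrafilter S, (𝒱 : Filter S) ≤ cofinite ∧ A ∈ 𝒱 := by
  have := hA.cofinite_inf_principal_neBot
  obtain ⟨𝒱, h𝒱⟩ := Ultrafilter.exists_le (cofinite ⊓ 𝓟 A)
  exact ⟨𝒱, h𝒱.trans inf_le_left, le_principal_iff.1 (h𝒱.trans inf_le_right)⟩

theorem exists_ultrafilter_vanishingOn_notMem {A : Set S} (hA : A.Infinite)
    (U : Ultrafilter (S → Bool)) :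
    ∃ V : Ultrafilter (S → Bool), zeroSetTrace V ⊆ zeroSetTrace U ∧ vanishingOn A ∉ V ∧
      ∀ B, (A ∩ B).Finite → (vanishingOn B ∈ V ↔ vanishingOn B ∈ U) := by
  classical
  obtain ⟨𝒱, h𝒱, hAV⟩ := exists_ultrafilter_le_cofinite_mem hA
  refine ⟨switchOn U 𝒱, zeroSetTrace_switchOn_subset h𝒱, vanishingOn_notMem_switchOn hAV,
    fun B hAB => vanishingOn_mem_switchOn_iff ?_⟩
  filter_upwards [hAV, h𝒱 hAB.compl_mem_cofinite] with s hsA hs hsB using hs ⟨hsA, hsB⟩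

variable {A : ι → Set S}

theorem exists_monotone_zeroSetTrace_vanishingOn [LinearOrder ι] (hA : ∀ i, (A i).Infinite)
    (hd : Pairwise fun i j => (A i ∩ A j).Finite) (F : Finset ι) :
    ∃ W : ι → Ultrafilter (S → Bool), Monotone (fun i => zeroSetTrace (W i)) ∧
      ∀ i j, vanishingOn (A i) ∈ W j ↔ (i ∈ F → i < j) := by
  classical
  induction F using Finset.induction_on_min with
  | empty =>
    refine ⟨fun _ => pure fun _ => false, monotone_const, fun i j => ?_⟩
    simp [vanishingOn]
  | insert a F ha ih =>
    obtain ⟨W, hW, hsep⟩ := ih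
    obtain ⟨V, hVW, haV, hV⟩ := exists_ultrafilter_vanishingOn_notMem (hA a) (W a)
    refine ⟨fun j => if j ≤ a then V else W j, fun i j hij => ?_, fun i j => ?_⟩
    · by_cases hj : j ≤ a
      · simp only [hj, hij.trans hj, if_true, le_refl]
      · by_cases hi : i ≤ a
        · simpa only [hi, hj, if_true, if_false] using hVW.trans (hW (not_le.1 hj).le)
        · simpa only [hi, hj, if_false] using hW hij
    · have haF : a ∉ F := fun h => (ha a h).false
      rcases eq_or_ne i a with rfl | hia
      · by_cases hj : j ≤ i
        · simp [hj, haV]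
        · simp [hj, hsep, haF, not_le.1 hj]
      · by_cases hj : j ≤ a
        · simp only [hj, if_true, hV (A i) (hd hia.symm), hsep, Finset.mem_insert, hia, false_or]
          exact forall_congr' fun hi =>
            iff_of_false (ha i hi).not_gt (hj.trans_lt (ha i hi)).not_gt
        · simp [hj, hsep, hia]

theorem exists_strictMono_zeroSetTrace [Countable S] [LinearOrder ι] (hA : ∀ i, (A i).Infinite)
    (hd : Pairwise fun i j => (A i ∩ A j).Finite) :
    ∃ W : ι → Ultrafilter (S → Bool), StrictMono fun i => zeroSetTrace (W i) := by
  obtain ⟨W, hW, hsep⟩ := exists_monotone_zeroSetTrace_of_forall_finset (fun i => vanishingOn (A i))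
    fun F => by
      obtain ⟨W, hW, hsep⟩ := exists_monotone_zeroSetTrace_vanishingOn hA hd F
      exact ⟨W, hW, fun i hi j => by simp [hsep, hi]⟩
  exact ⟨W, strictMono_zeroSetTrace_of_mem_iff_lt hW
    (fun i => mem_zeroSets_of_isClosed (isClosed_vanishingOn (A i))) hsep⟩

end AlmostDisjoint

section Branch

variable {α : Type*} [Encodable α]

/-- The branch of the tree of finite sequences that is determined by `x`, with finite sequences
coded by natural numbers. -/
def branch (x : ℕ → α) : Set ℕ :=
  Set.range fun k => Encodable.encode (List.ofFn fun i : Fin k => x i)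

theorem infinite_branch (x : ℕ → α) : (branch x).Infinite :=
  Set.infinite_range_of_injective fun k l h => by
    simpa using congrArg List.length (Encodable.encode_injective h)

theorem finite_branch_inter_branch {x y : ℕ → α} (hxy : x ≠ y) :
    (branch x ∩ branch y).Finite := by
  obtain ⟨n, hn⟩ := Function.ne_iff.1 hxy
  refine Set.Finite.subset
    ((Set.finite_Iic n).image fun k => Encodable.encode (List.ofFn fun i : Fin k => x i)) ?_
  rintro _ ⟨⟨k, rfl⟩, l, h⟩
  refine ⟨k, Set.mem_Iic.2 <| not_lt.1 fun hk => hn ?_, rfl⟩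
  have h' := Encodable.encode_injective h
  obtain rfl : l = k := by simpa using congrArg List.length h'
  exact (congrFun (List.ofFn_injective h') ⟨n, hk⟩).symm

end Branch

theorem exists_isClosedEmbedding_nat_bool (X : Type*) [TopologicalSpace X] [PolishSpace X]
    [Uncountable X] : ∃ e : (ℕ → Bool) → X, IsClosedEmbedding e := by
  obtain ⟨e, -, hec, hei⟩ := (isClosed_univ (X := X)).exists_nat_bool_injection_of_not_countable
    Set.not_countable_univ
  exact ⟨e, hec.isClosedEmbedding hei⟩

theorem exists_injective_nat_bool {ι : Type*} (hι : Cardinal.mk ι ≤ Cardinal.continuum) :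
    ∃ x : ι → ℕ → Bool, Function.Injective x := by
  have hle : Cardinal.lift.{0} (Cardinal.mk ι) ≤ Cardinal.lift (Cardinal.mk (ℕ → Bool)) := by
    simpa using hι
  obtain ⟨f⟩ := Cardinal.lift_mk_le'.1 hle
  exact ⟨f, f.injective⟩

theorem corollary5p7_general {X ι : Type*} [TopologicalSpace X] [PolishSpace X] [Uncountable X]
    [LinearOrder ι] (hι : Cardinal.mk ι ≤ Cardinal.continuum) :
    ∃ Q : ι → Set (Set X), (∀ i, IsPrimeZFilter (Q i)) ∧ StrictMono Q := by
  obtain ⟨x, hx⟩ := exists_injective_nat_bool hι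
  obtain ⟨W, hW⟩ := exists_strictMono_zeroSetTrace (fun i => infinite_branch (x i))
    fun i j hij => finite_branch_inter_branch (hx.ne hij)
  obtain ⟨e, he⟩ := exists_isClosedEmbedding_nat_bool X
  exact ⟨fun i => zeroSetTrace ((W i).map e), fun i => isPrimeZFilter_zeroSetTrace _,
    strictMono_zeroSetTrace_map he hW⟩

theorem corollary5p7 (κ : Ordinal) (hκ : κ.card = Cardinal.continuum) :
    ∃ Q : Set.Iio κ → Set (Set ℝ), (∀ α, IsPrimeZFilter (Q α)) ∧ StrictMono Q :=
  corollary5p7_general (by simp [Cardinal.mk_Iio_ordinal, hκ])
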